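/- **Theorem.** Let $M$ be a smooth (i.e. $C^\infty$), Hausdorff, paracompact, finite-dimensional manifold (without boundary). A *local vector field* on $M$ is a $C^\infty$ vector field $X$ defined on an open (possibly empty) subset $U_X\subseteq M$. Let $H$ be a distribution on $M$, i.e. a choice of a linear subspace $H_x\subseteq T_xM$ for every $x\in M$ (its dimension may vary with $x$). A local vector field $X$ is *horizontal* if $X(x)\in H_x$ for all $x\in U_X$. Suppose that * $H$ is *locally finitely generated*: every point of $M$ has an open neighbourhood $U$ and finitely many horizontal vector fields $X_1,\dots,X_k$ defined on $U$ such that $X_1(y),\dots,X_k(y)$ span $H_y$ for every $y\in U$; * $H$ is *bracket generating*: if $\mathcal L$ is the smallest set of local vector fields that contains all local horizontal vector fields and is closed under the Lie bracket (where $[X,Y]$ is defined on $U_X\cap U_Y$), then for every $x\in M$ the vectors $X(x)$ with $X\in\mathcal L$, $x\in U_X$, span $T_xM$. Let $r\ge 0$ be an integer and let $f:M\to\mathbb R$ be a function, not assumed to be continuous. Suppose that for every local horizontal vector field $X$, with maximal local flow $\mathrm{Fl}^X$, the derivative $$(Xf)(x):=\frac{\mathrm d}{\mathrm dt}\Big|_{t=0}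 f\bigl(\mathrm{Fl}^X_t(x)\bigr)$$ exists for every $x\in U_X$, and the function $Xf:U_X\to\mathbb R$ is of class $C^r$. Then $f$ is of class $C^r$ on $M$. -/

import Mathlib

open scoped Manifold ContDiff Topology

noncomputable section

namespace Subriemannian

variable (E : Type*) [NormedAddCommGroup E] [NormedSpace ℝ E]
  (M : Type*) [TopologicalSpace M] [ChartedSpace E M] [IsManifold 𝓘(ℝ, E) ∞ M]

/-- A local (smooth) vector field on `M`: a smooth vector field `X` on an open subset `dom` of `M`,
possibly empty. The values of `X` outside `dom` are irrelevant. -/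
structure LocalVectorField where
  /-- the domain of definition -/
  dom : Set M
  /-- the vector field -/
  field : ∀ x : M, TangentSpace 𝓘(ℝ, E) x
  isOpen_dom : IsOpen dom
  smooth : ContMDiffOn 𝓘(ℝ, E) 𝓘(ℝ, E).tangent ∞
    (fun x => (⟨x, field x⟩ : TangentBundle 𝓘(ℝ, E) M)) dom

/-- A distribution on `M`: a linear subspace of every tangent space. -/
abbrev Distribution : Type _ := ∀ x : M, Submodule ℝ (TangentSpace 𝓘(ℝ, E) x)

variable {E M}

namespace LocalVectorField

/-- The Lie bracket `[X, Y]` of two local vector fields, defined where both are defined. -/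
def bracket [FiniteDimensional ℝ E] (X Y : LocalVectorField E M) : LocalVectorField E M where
  dom := X.dom ∩ Y.dom
  field := VectorField.mlieBracket 𝓘(ℝ, E) X.field Y.field
  isOpen_dom := X.isOpen_dom.inter Y.isOpen_dom
  smooth := by
    have : CompleteSpace E := FiniteDimensional.complete ℝ E
    have : IsManifold 𝓘(ℝ, E) (((⊤ : ℕ∞) : WithTop ℕ∞) + 1) M := by
      simpa using (inferInstance : IsManifold 𝓘(ℝ, E) ∞ M)
    have : IsManifold 𝓘(ℝ, E) (minSmoothness ℝ 2) M := by
      simpa using IsManifold.of_le (I := 𝓘(ℝ, E)) (M := M) (m := 2) (n := ∞)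
        (WithTop.coe_le_coe.2 le_top)
    intro x hx
    exact (ContMDiffAt.mlieBracket_vectorField (m := ⊤) (n := ⊤)
      (X.smooth.contMDiffAt (X.isOpen_dom.mem_nhds hx.1))
      (Y.smooth.contMDiffAt (Y.isOpen_dom.mem_nhds hx.2)) (by simp)).contMDiffWithinAt

open Classical in
/-- The maximal local flow `Fl^X_t(x)`: the value at time `t` of the integral curve of `X` that
starts at `x`, if this integral curve exists on an open interval containing `0` and `t` (and the
value `x` otherwise). -/
def flow (X : LocalVectorField E M) (t : ℝ) (x : M) : M :=
  if h : ∃ γ : ℝ → M, γ 0 = x ∧ ∃ a b : ℝ, 0 ∈ Set.Ioo a b ∧ t ∈ Set.Ioo a b ∧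
      Set.MapsTo γ (Set.Ioo a b) X.dom ∧ IsMIntegralCurveOn γ X.field (Set.Ioo a b)
  then h.choose t else x

/-- The derivative `d/dt|₀ f (Fl^X_t(x))` exists. -/
def HasFlowDerivAt (X : LocalVectorField E M) (f : M → ℝ) (x : M) : Prop :=
  DifferentiableAt ℝ (fun t => f (X.flow t x)) 0

/-- `(X f)(x) = d/dt|₀ f (Fl^X_t(x))`. -/
def flowDeriv (X : LocalVectorField E M) (f : M → ℝ) (x : M) : ℝ :=
  deriv (fun t => f (X.flow t x)) 0

end LocalVectorField

/-- The distribution spanned by a set of local vector fields. -/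
def spanDistribution (V : Set (LocalVectorField E M)) : Distribution E M :=
  fun x => Submodule.span ℝ {v | ∃ X ∈ V, x ∈ X.dom ∧ X.field x = v}

/-- A set of local vector fields is involutive if it is closed under Lie brackets. -/
def IsInvolutive [FiniteDimensional ℝ E] (V : Set (LocalVectorField E M)) : Prop :=
  ∀ X ∈ V, ∀ Y ∈ V, X.bracket Y ∈ V

/-- The Lie hull: the smallest involutive set of local vector fields containing `V`. -/
def lieHull [FiniteDimensional ℝ E] (V : Set (LocalVectorField E M)) :
    Set (LocalVectorField E M) :=
  ⋂₀ {W | V ⊆ W ∧ IsInvolutive W}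

namespace Distribution

/-- The set of local horizontal vector fields. -/
def horizontalFields (H : Distribution E M) : Set (LocalVectorField E M) :=
  {X | ∀ x ∈ X.dom, X.field x ∈ H x}

/-- Near every point, `H` is spanned by finitely many horizontal vector fields. -/
def IsLocallyFinitelyGenerated (H : Distribution E M) : Prop :=
  ∀ x : M, ∃ U : Set M, IsOpen U ∧ x ∈ U ∧ ∃ (k : ℕ) (X : Fin k → LocalVectorField E M),
    (∀ i, (X i).dom = U) ∧ (∀ i, X i ∈ H.horizontalFields) ∧
    ∀ y ∈ U, Submodule.span ℝ (Set.range fun i => (X i).field y) = H y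

/-- The local horizontal vector fields together with their iterated Lie brackets span `TM`. -/
def IsBracketGenerating [FiniteDimensional ℝ E] (H : Distribution E M) : Prop :=
  ∀ x : M, spanDistribution (lieHull H.horizontalFields) x = ⊤

end Distribution

end Subriemannian

end

/-!
The function `f` is not assumed to be continuous, but along the flow of a horizontal field `X` its
increment is as regular as `X f`: since `s ↦ f (Fl_s y)` has the continuous derivative
`(X f) (Fl_s y)`,
`f (Fl_s y) - f y = ∫₀^s (X f) (Fl_u y) du =: G (s, y)`,
and `G` is of class `C^r` jointly in time and initial value (`IsDerivAlong.exists_flowBox`). Two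
consequences follow. First, the set of points at which `f` is not `C^r` is invariant under the
local flows of horizontal fields. Second, if `f ∘ Φ` is `C^r` for some map `Φ`, then so is `f`
composed with `(s, t) ↦ Fl_s (Φ t)`.

Suppose that the singular set of `f` is not empty. Then some point, regarded as a map from a
zero-dimensional space, is an immersion into the singular set along which `f` is `C^r`
(`IsSingularImmersionAt`). As long as some horizontal field is not tangent to such an immersion `Φ`,
its flow produces one with one more parameter (`IsSingularImmersionAt.exists_extend`). If all
horizontal fields are tangent to `Φ`, then so are their iterated brackets
(`lieBracket_mem_range_fderiv`), so that by bracket generation `Φ` has full rank. But at full rank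
`Φ` is a local diffeomorphism, and `f` is `C^r` at the points `Φ t` because `f ∘ Φ` is
(`IsSingularImmersionAt.finrank_lt`), although `Φ` takes values in the singular set.

The joint regularity of `G` and of the flow comes from the implicit function theorem, applied to the
integral equation of the flow in the Banach space `C(unitInterval, E)`. This rests on the fact that
the composition operator `γ ↦ h ∘ γ` on continuous curves is as smooth as `h`
(`contDiff_continuousMap_comp`).
-/

noncomputable section

namespace Subriemannian

/-! ### Composition operators on spaces of continuous functions -/

section Composition

/-- Pointwise evaluation of a continuous family of linear maps on a continuous family of vectors,
as a continuous bilinear map. -/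
def pointwiseApply (K E F : Type*) [TopologicalSpace K] [CompactSpace K]
    [NormedAddCommGroup E] [NormedSpace ℝ E] [NormedAddCommGroup F] [NormedSpace ℝ F] :
    C(K, E →L[ℝ] F) →L[ℝ] C(K, E) →L[ℝ] C(K, F) :=
  LinearMap.mkContinuous₂
    (LinearMap.mk₂ ℝ
      (fun (A : C(K, E →L[ℝ] F)) (η : C(K, E)) => (⟨fun x => A x (η x), by fun_prop⟩ : C(K, F)))
      (fun _ _ _ => by ext; simp) (fun _ _ _ => by ext; simp)
      (fun _ _ _ => by ext; simp) (fun _ _ _ => by ext; simp)) 1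
    (fun A η => by
      rw [ContinuousMap.norm_le _ (by positivity)]
      intro x
      simp only [LinearMap.mk₂_apply, ContinuousMap.coe_mk, one_mul]
      exact (A x).le_of_opNorm_le_of_le (A.norm_coe_le_norm x) (η.norm_coe_le_norm x))

variable {K : Type*} [TopologicalSpace K] [CompactSpace K]

/-- The derivative of the composition operator `γ ↦ h ∘ γ` at `γ` is `η ↦ (x ↦ h' (γ x) (η x))`.
The remainder is uniform because `γ ↦ h' ∘ γ` is continuous in the compact-open topology. -/
theorem hasFDerivAt_continuousMap_comp {E F : Type*}
    [NormedAddCommGroup E] [NormedSpace ℝ E] [NormedAddCommGroup F] [NormedSpace ℝ F]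
    (h : C(E, F)) (h' : C(E, E →L[ℝ] F)) (hh : ∀ x, HasFDerivAt h (h' x) x) (γ : C(K, E)) :
    HasFDerivAt (fun η : C(K, E) => h.comp η) (pointwiseApply K E F (h'.comp γ)) γ := by
  rw [hasFDerivAt_iff_isLittleO, Asymptotics.isLittleO_iff]
  intro ε hε
  have hc : Continuous (fun η : C(K, E) => h'.comp η) := h'.continuous_postcomp
  obtain ⟨δ, hδ, hball⟩ := Metric.mem_nhds_iff.1
    (hc.continuousAt.preimage_mem_nhds (Metric.ball_mem_nhds (h'.comp γ) hε))
  filter_upwards [Metric.ball_mem_nhds γ hδ] with η hη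
  rw [ContinuousMap.norm_le _ (by positivity)]
  intro x
  -- every point `z` near `γ x` lies on a translate of `γ`, to which the continuity of the
  -- composition with `h'` applies
  have key : ∀ z ∈ Metric.ball (γ x) δ, ‖h' z - h' (γ x)‖ ≤ ε := by
    intro z hz
    have h1 : dist (γ + ContinuousMap.const K (z - γ x)) γ < δ := by
      rw [dist_eq_norm, add_sub_cancel_left]
      have : ‖ContinuousMap.const K (z - γ x)‖ ≤ ‖z - γ x‖ :=
        (ContinuousMap.norm_le _ (norm_nonneg _)).2 fun _ => le_rfl
      exact this.trans_lt (by simpa [dist_eq_norm] using hz)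
    have h2 := (ContinuousMap.dist_apply_le_dist x).trans (le_of_lt (hball h1))
    simpa [dist_eq_norm] using h2
  have hmem : η x ∈ Metric.ball (γ x) δ :=
    (ContinuousMap.dist_apply_le_dist x).trans_lt hη
  have := (convex_ball (γ x) δ).norm_image_sub_le_of_norm_hasFDerivWithin_le'
    (fun z _ => (hh z).hasFDerivWithinAt) key (Metric.mem_ball_self hδ) hmem
  calc _ ≤ ε * ‖η x - γ x‖ := this
    _ ≤ ε * ‖η - γ‖ := by
      gcongr
      exact (η - γ).norm_coe_le_norm x

universe u v

/-- The case of `contDiff_continuousMap_comp` in which the universe of `F` contains that of `E`: the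
induction passes from `h` to its derivative, which takes values in `E →L[ℝ] F`. -/
theorem contDiff_continuousMap_comp_aux {E : Type v} [NormedAddCommGroup E] [NormedSpace ℝ E]
    (n : ℕ) : ∀ {F : Type (max u v)} [NormedAddCommGroup F] [NormedSpace ℝ F]
      (h : C(E, F)), ContDiff ℝ n h → ContDiff ℝ n (fun γ : C(K, E) => h.comp γ) := by
  induction n with
  | zero =>
    intro F _ _ h _
    exact contDiff_zero.2 h.continuous_postcomp
  | succ n ih =>
    intro F _ _ h hh
    push_cast at hh ⊢
    obtain ⟨h', hc, hd⟩ := (contDiff_succ_iff_hasFDerivAt (n := n)).1 hh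
    refine (contDiff_succ_iff_hasFDerivAt (n := n)).2
      ⟨fun γ => pointwiseApply K E F ((⟨h', hc.continuous⟩ : C(E, E →L[ℝ] F)).comp γ), ?_,
        fun γ => hasFDerivAt_continuousMap_comp h ⟨h', hc.continuous⟩ hd γ⟩
    exact (pointwiseApply K E F).contDiff.comp (ih ⟨h', hc.continuous⟩ hc)

/-- If `h` is of class `C^n`, then so is the composition operator `γ ↦ h ∘ γ` on `C(K, E)`. -/
theorem contDiff_continuousMap_comp {E : Type v} [NormedAddCommGroup E] [NormedSpace ℝ E]
    {F : Type u} [NormedAddCommGroup F] [NormedSpace ℝ F] {n : ℕ} (h : C(E, F))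
    (hh : ContDiff ℝ n h) : ContDiff ℝ n (fun γ : C(K, E) => h.comp γ) := by
  -- lift `F` to a universe that contains the maps `E →L[ℝ] F`
  let e : ULift.{v} F ≃L[ℝ] F := ContinuousLinearEquiv.ulift
  let h₁ : C(E, ULift.{v} F) := ⟨fun x => e.symm (h x), by fun_prop⟩
  have h1 : ContDiff ℝ n (fun γ : C(K, E) => h₁.comp γ) :=
    contDiff_continuousMap_comp_aux.{u, v} n h₁ (e.symm.contDiff.comp hh)
  exact ((e : ULift.{v} F →L[ℝ] F).compLeftContinuous ℝ K).contDiff.comp h1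

end Composition

/-! ### Smooth dependence of integral curves on time and initial value -/

section Flow

variable {E : Type*} [NormedAddCommGroup E] [NormedSpace ℝ E]

/-- The operator `γ ↦ (τ ↦ ∫₀^τ γ)` on continuous functions on the unit interval. -/
def primitive (E : Type*) [NormedAddCommGroup E] [NormedSpace ℝ E] :
    C(unitInterval, E) →L[ℝ] C(unitInterval, E) :=
  LinearMap.mkContinuous
    { toFun := fun γ => ⟨fun τ => ∫ σ in (0 : ℝ)..τ, γ (Set.projIcc 0 1 zero_le_one σ), by
        have hc : Continuous fun σ : ℝ => γ (Set.projIcc 0 1 zero_le_one σ) :=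
          γ.continuous.comp continuous_projIcc
        exact (intervalIntegral.continuous_primitive
          (fun a b => hc.intervalIntegrable a b) 0).comp continuous_subtype_val⟩
      map_add' := fun γ η => by
        ext τ
        have hc : ∀ γ : C(unitInterval, E),
            Continuous fun σ : ℝ => γ (Set.projIcc 0 1 zero_le_one σ) :=
          fun γ => γ.continuous.comp continuous_projIcc
        exact intervalIntegral.integral_add ((hc γ).intervalIntegrable _ _)
          ((hc η).intervalIntegrable _ _)
      map_smul' := fun a γ => by
        ext τ
        exact intervalIntegral.integral_smul a _ }
    1 (fun γ => by
      rw [ContinuousMap.norm_le _ (by positivity)]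
      intro τ
      have h1 := intervalIntegral.norm_integral_le_of_norm_le_const (a := 0) (b := (τ : ℝ))
        (f := fun σ : ℝ => γ (Set.projIcc 0 1 zero_le_one σ)) (C := ‖γ‖)
        (fun _ _ => γ.norm_coe_le_norm _)
      refine h1.trans ?_
      rw [sub_zero, abs_of_nonneg τ.2.1, one_mul]
      exact mul_le_of_le_one_right (norm_nonneg _) τ.2.2)

theorem primitive_apply (γ : C(unitInterval, E)) (τ : unitInterval) :
    primitive E γ τ = ∫ σ in (0 : ℝ)..τ, γ (Set.projIcc 0 1 zero_le_one σ) := rfl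

/-- The map whose zeros `((s, y), γ)` are the curves with `γ τ = y + s ∫₀^τ X (γ σ) dσ`, that is,
the integral curves of `X` starting at `y`, with time rescaled by `s`. -/
def integralEquation (X : C(E, E)) (q : (ℝ × E) × C(unitInterval, E)) : C(unitInterval, E) :=
  q.2 - ContinuousMap.const unitInterval q.1.2 - q.1.1 • primitive E (X.comp q.2)

theorem contDiff_integralEquation {n : ℕ} (X : C(E, E)) (hX : ContDiff ℝ n X) :
    ContDiff ℝ n (integralEquation X) := by
  have h1 : ContDiff ℝ n (fun q : (ℝ × E) × C(unitInterval, E) => X.comp q.2) :=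
    (contDiff_continuousMap_comp X hX).comp contDiff_snd
  have h2 : ContDiff ℝ n
      (fun q : (ℝ × E) × C(unitInterval, E) => ContinuousMap.const unitInterval q.1.2) := by
    let L : E →L[ℝ] C(unitInterval, E) := LinearMap.mkContinuous
      { toFun := fun y => ContinuousMap.const unitInterval y
        map_add' := fun _ _ => rfl
        map_smul' := fun _ _ => rfl } 1 (fun y => by
          rw [one_mul]
          exact (ContinuousMap.norm_le _ (norm_nonneg _)).2 fun _ => le_rfl)
    exact L.contDiff.comp (contDiff_snd.comp contDiff_fst)
  exact (contDiff_snd.sub h2).sub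
    ((contDiff_fst.comp contDiff_fst).smul ((primitive E).contDiff.comp h1))

/-- At time zero the partial derivative of the integral equation in the unknown curve is the
identity, so that the implicit function theorem applies. -/
theorem fderiv_integralEquation_inr (X : C(E, E)) (hX : ContDiff ℝ 1 X) (p : E)
    (γ : C(unitInterval, E)) :
    fderiv ℝ (integralEquation X) ((0, p), γ) ∘L .inr ℝ (ℝ × E) C(unitInterval, E) =
      ContinuousLinearMap.id ℝ _ := by
  have h1 : HasFDerivAt (integralEquation X) (fderiv ℝ (integralEquation X) ((0, p), γ))
      ((0, p), γ) :=
    ((contDiff_integralEquation (n := 1) X hX).differentiable (by simp) _).hasFDerivAt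
  have h2 : HasFDerivAt (fun η : C(unitInterval, E) => (((0 : ℝ), p), η))
      (.inr ℝ (ℝ × E) C(unitInterval, E)) γ :=
    hasFDerivAt_prodMk_right _ _
  have h3 := h1.comp γ h2
  refine h3.unique ?_
  have h4 : integralEquation X ∘ (fun η : C(unitInterval, E) => (((0 : ℝ), p), η)) =
      fun η => η - ContinuousMap.const unitInterval p := by
    ext η; simp [integralEquation]
  rw [h4]
  exact (hasFDerivAt_id γ).sub_const _

/-- The local flow `α (s, y)` of a `C^N` vector field, together with the map `Γ` that sends
`(s, y)` to the whole rescaled integral curve `τ ↦ α (τ s, y)` on the unit interval; `Γ` is of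
class `C^N` as a map into a Banach space of curves. -/
theorem exists_contDiffAt_flow [CompleteSpace E] {N : ℕ} (hN : 1 ≤ N) (X : C(E, E))
    (hX : ContDiff ℝ N X) (p : E) :
    ∃ (Γ : ℝ × E → C(unitInterval, E)) (α : ℝ × E → E), ContDiffAt ℝ N Γ (0, p) ∧
      ∃ ε > 0, ∀ y ∈ Metric.ball p ε, α (0, y) = y ∧ ∀ s ∈ Set.Ioo (-ε) ε,
        HasDerivAt (fun t => α (t, y)) (X (α (s, y))) s ∧
        ∀ τ : unitInterval, Γ (s, y) τ = α (τ * s, y) := by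
  have hX1 : ContDiff ℝ 1 X := hX.of_le (by exact_mod_cast hN)
  obtain ⟨ε₀, hε₀, a, r, L, K, hr, hpl⟩ :=
    IsPicardLindelof.of_contDiffAt_one (x₀ := p) hX1.contDiffAt
  obtain ⟨β, hβ, hβc⟩ :=
    (hpl 0).exists_forall_mem_closedBall_eq_hasDerivWithinAt_continuousOn
  have hder : ∀ y ∈ Metric.closedBall p (r : ℝ), ∀ t ∈ Set.Ioo (-ε₀) ε₀,
      HasDerivAt (fun t => β (y, t)) (X (β (y, t))) t := by
    intro y hy t ht
    refine ((hβ y hy).2 t ⟨?_, ?_⟩).hasDerivAt (Icc_mem_nhds ?_ ?_) <;> linarith [ht.1, ht.2]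
  have hβp : ContinuousAt β (p, 0) := hβc.continuousAt (prod_mem_nhds
    (Metric.closedBall_mem_nhds p (by exact_mod_cast hr))
    (Icc_mem_nhds (by linarith) (by linarith)))
  have hβp0 : β (p, 0) = p := (hβ p (Metric.mem_closedBall_self (by positivity))).1
  set u : (ℝ × E) × C(unitInterval, E) := ((0, p), ContinuousMap.const unitInterval p) with hu
  have hcd : ContDiffAt ℝ N (integralEquation X) u := (contDiff_integralEquation X hX).contDiffAt
  have hN0 : (N : WithTop ℕ∞) ≠ 0 := by
    have : N ≠ 0 := by omega
    exact_mod_cast this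
  have hinv : (fderiv ℝ (integralEquation X) u ∘L
      .inr ℝ (ℝ × E) C(unitInterval, E)).IsInvertible := by
    rw [fderiv_integralEquation_inr X hX1]
    exact ⟨ContinuousLinearEquiv.refl ℝ _, rfl⟩
  have hu0 : integralEquation X u = 0 := by simp [integralEquation, hu]
  refine ⟨hcd.implicitFunction hN0 hinv, fun q => β (q.2, q.1),
    hcd.contDiffAt_implicitFunction hN0 hinv, ?_⟩
  -- the implicit function is the rescaled Picard-Lindelöf curve, by uniqueness of small solutions
  obtain ⟨δ, hδ, hiff⟩ := Metric.eventually_nhds_iff.1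
    (hcd.eventually_apply_eq_iff_implicitFunction hN0 hinv)
  obtain ⟨δ', hδ', hclose⟩ := Metric.continuousAt_iff.1 hβp (δ / 2) (by positivity)
  refine ⟨min (min δ δ') (min ε₀ r), by positivity, fun y hy => ?_⟩
  simp only [Metric.mem_ball, lt_min_iff] at hy
  have hyr : y ∈ Metric.closedBall p (r : ℝ) := hy.2.2.le
  refine ⟨(hβ y hyr).1, fun s hs => ?_⟩
  have hs' : |s| < min (min δ δ') (min ε₀ r) := abs_lt.2 hs
  simp only [lt_min_iff] at hs'
  refine ⟨hder y hyr s (abs_lt.1 hs'.2.1), ?_⟩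
  have hmul : ∀ σ ∈ Set.Icc (0 : ℝ) 1, |σ * s| ≤ |s| := by
    intro σ hσ
    rw [abs_mul, abs_of_nonneg hσ.1]
    exact mul_le_of_le_one_left (abs_nonneg _) hσ.2
  have hcurve : ∀ σ ∈ Set.Icc (0 : ℝ) 1,
      HasDerivAt (fun σ => β (y, σ * s)) (s • X (β (y, σ * s))) σ := by
    intro σ hσ
    have h1 := hder y hyr (σ * s) (abs_lt.1 ((hmul σ hσ).trans_lt hs'.2.1))
    exact h1.scomp σ (hasDerivAt_mul_const s)
  let c : C(unitInterval, E) := ⟨fun τ => β (y, τ * s), by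
    rw [continuous_iff_continuousAt]
    intro τ
    exact ((hcurve τ τ.2).continuousAt).comp continuous_subtype_val.continuousAt⟩
  have hproj : ∀ σ ∈ Set.Icc (0 : ℝ) 1,
      c (Set.projIcc 0 1 zero_le_one σ) = β (y, σ * s) := by
    intro σ hσ
    simp [c, Set.projIcc_of_mem _ hσ]
  have hdist : dist ((s, y), c) u < δ := by
    rw [hu, Prod.dist_eq, Prod.dist_eq]
    have hc : dist c (ContinuousMap.const unitInterval p) ≤ δ / 2 := by
      rw [ContinuousMap.dist_le (by positivity)]
      intro τ
      have hlt : dist ((y, (τ : ℝ) * s) : E × ℝ) (p, 0) < δ' := by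
        rw [Prod.dist_eq]
        refine max_lt hy.1.2 ?_
        rw [Real.dist_eq, sub_zero]
        exact (hmul τ τ.2).trans_lt hs'.1.2
      have := hclose hlt
      rw [hβp0] at this
      exact this.le
    refine max_lt (max_lt ?_ hy.1.1) (by linarith)
    rw [Real.dist_eq, sub_zero]
    exact hs'.1.1
  have hzero : integralEquation X ((s, y), c) = integralEquation X u := by
    rw [hu0]
    ext τ
    have hsub : Set.uIcc (0 : ℝ) τ ⊆ Set.Icc 0 1 := by
      rw [Set.uIcc_of_le τ.2.1]
      exact Set.Icc_subset_Icc_right τ.2.2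
    have hftc : ∫ σ in (0 : ℝ)..τ, s • X (β (y, σ * s)) = β (y, τ * s) - β (y, 0 * s) := by
      refine intervalIntegral.integral_eq_sub_of_hasDerivAt
        (fun σ hσ => hcurve σ (hsub hσ)) (ContinuousOn.intervalIntegrable ?_)
      intro σ hσ
      exact ((X.continuous.continuousAt.comp
        (hcurve σ (hsub hσ)).continuousAt).const_smul s).continuousWithinAt
    have hcongr : ∫ σ in (0 : ℝ)..τ, (X.comp c) (Set.projIcc 0 1 zero_le_one σ) =
        ∫ σ in (0 : ℝ)..τ, X (β (y, σ * s)) := by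
      refine intervalIntegral.integral_congr fun σ hσ => ?_
      simp only [ContinuousMap.comp_apply, hproj σ (hsub hσ)]
    rw [intervalIntegral.integral_smul, zero_mul, (hβ y hyr).1] at hftc
    simp only [integralEquation, ContinuousMap.sub_apply, ContinuousMap.smul_apply,
      primitive_apply, hcongr, hftc, ContinuousMap.const_apply, ContinuousMap.zero_apply]
    simp [c]
  have hfin := (hiff hdist).1 hzero
  exact fun τ => DFunLike.congr_fun hfin τ

/-- `g` is the derivative of `f` along the integral curves of the vector field `X` in `W`. -/
def IsDerivAlong (f : E → ℝ) (X : E → E) (W : Set E) (g : E → ℝ) : Prop :=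
  ∀ (γ : ℝ → E) (a b : ℝ), (∀ t ∈ Set.Ioo a b, γ t ∈ W ∧ HasDerivAt γ (X (γ t)) t) →
    ∀ t ∈ Set.Ioo a b, HasDerivAt (fun s => f (γ s)) (g (γ t)) t

/-- A function of class `C^n` at a point agrees near it with a globally `C^n` function. -/
theorem _root_.ContDiffAt.exists_contDiff_eventuallyEq [FiniteDimensional ℝ E]
    {F : Type*} [NormedAddCommGroup F] [NormedSpace ℝ F] {n : ℕ} {h : E → F} {p : E}
    (hh : ContDiffAt ℝ n h p) : ∃ h' : E → F, ContDiff ℝ n h' ∧ h' =ᶠ[𝓝 p] h := by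
  obtain ⟨ε, hε, hball⟩ := Metric.eventually_nhds_iff_ball.1 (hh.eventually (by simp))
  let χ : ContDiffBump p := ⟨ε / 4, ε / 2, by positivity, by linarith⟩
  refine ⟨fun x => χ x • h x, ?_, ?_⟩
  · rw [contDiff_iff_contDiffAt]
    intro x
    by_cases hx : x ∈ Metric.ball p ε
    · exact χ.contDiffAt.smul (hball x hx)
    · have hx' : x ∉ tsupport χ := by
        rw [χ.tsupport_eq]
        intro hmem
        exact hx (Metric.closedBall_subset_ball (by simp only [χ]; linarith) hmem)
      have h0 : (fun x => χ x • h x) =ᶠ[𝓝 x] fun _ => 0 := by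
        filter_upwards [notMem_tsupport_iff_eventuallyEq.1 hx'] with z hz
        simp [hz]
      exact contDiffAt_const.congr_of_eventuallyEq h0
  · filter_upwards [χ.eventuallyEq_one] with x hx
    simp [hx]

/-- A flow box: along the local flow `Φ` of `X`, the function `f`, which need not even be
continuous, changes by an amount `G` that depends on time and initial value in a `C^r` way, because
`G (s, y)` is the integral of the `C^r` function `g = X f` along the flow line of `y`. -/
theorem IsDerivAlong.exists_flowBox [FiniteDimensional ℝ E] {N r : ℕ} (hN : 1 ≤ N) (hrN : r ≤ N)
    {f g : E → ℝ} {X : E → E} {W : Set E} (hfg : IsDerivAlong f X W g) {p : E} (hW : W ∈ 𝓝 p)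
    (hX : ContDiffAt ℝ N X p) (hg : ContDiffAt ℝ r g p) :
    ∃ (Φ : ℝ × E → E) (G : ℝ × E → ℝ), ContDiffAt ℝ N Φ (0, p) ∧ ContDiffAt ℝ r G (0, p) ∧
      HasDerivAt (fun t => Φ (t, p)) (X p) 0 ∧
      ∀ᶠ q in 𝓝 ((0 : ℝ), p), Φ (0, q.2) = q.2 ∧ f (Φ q) = f q.2 + G q := by
  have : CompleteSpace E := FiniteDimensional.complete ℝ E
  obtain ⟨X', hX', hXX⟩ := hX.exists_contDiff_eventuallyEq
  obtain ⟨g', hg', hgg⟩ := hg.exists_contDiff_eventuallyEq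
  obtain ⟨Γ, α, hΓ, ε, hε, hα⟩ := exists_contDiffAt_flow hN ⟨X', hX'.continuous⟩ hX' p
  have hp := hα p (Metric.mem_ball_self hε)
  have hnhds : Set.Ioo (-ε) ε ×ˢ Metric.ball p ε ∈ 𝓝 ((0 : ℝ), p) :=
    prod_mem_nhds (Ioo_mem_nhds (by linarith) hε) (Metric.ball_mem_nhds p hε)
  have hαcd : ContDiffAt ℝ N α (0, p) := by
    have h1 : ContDiffAt ℝ N (fun q => Γ q 1) (0, p) :=
      (ContinuousMap.evalCLM ℝ (1 : unitInterval) :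
        C(unitInterval, E) →L[ℝ] E).contDiff.contDiffAt.comp _ hΓ
    refine h1.congr_of_eventuallyEq ?_
    filter_upwards [hnhds] with q hq
    have := ((hα q.2 hq.2).2 q.1 hq.1).2 1
    simpa using this.symm
  have hV : ∀ᶠ x in 𝓝 (α (0, p)), x ∈ W ∧ X' x = X x ∧ g' x = g x := by
    rw [hp.1]
    filter_upwards [hW, hXX, hgg] with x h1 h2 h3 using ⟨h1, h2, h3⟩
  obtain ⟨δ, hδ, hnear⟩ := Metric.eventually_nhds_iff.1 (hαcd.continuousAt.eventually hV)
  -- `G (s, y) = s ∫₀¹ g (α (σ s, y)) dσ`, which is `C^r` as a function of the whole curve `Γ (s, y)`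
  refine ⟨α, fun q => q.1 * primitive ℝ ((⟨g', hg'.continuous⟩ : C(E, ℝ)).comp (Γ q)) 1, hαcd,
    ?_, ?_, ?_⟩
  · have h1 : ContDiffAt ℝ r (fun q => (⟨g', hg'.continuous⟩ : C(E, ℝ)).comp (Γ q)) (0, p) :=
      (contDiff_continuousMap_comp (K := unitInterval) ⟨g', hg'.continuous⟩ hg').contDiffAt.comp _
        (hΓ.of_le (by exact_mod_cast hrN))
    exact contDiffAt_fst.mul (((ContinuousMap.evalCLM ℝ (1 : unitInterval)).comp
      (primitive ℝ)).contDiff.contDiffAt.comp _ h1)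
  · have := (hp.2 0 ⟨by linarith, hε⟩).1
    rw [hp.1] at this
    rwa [← hXX.self_of_nhds]
  · have hmin : 0 < min ε δ := lt_min hε hδ
    filter_upwards [prod_mem_nhds (Ioo_mem_nhds (neg_lt_zero.2 hmin) hmin)
      (Metric.ball_mem_nhds p hmin)] with q hq
    obtain ⟨s, y⟩ := q
    obtain ⟨hs, hy⟩ := hq
    simp only [Metric.mem_ball, lt_min_iff] at hy
    obtain ⟨hy0, hyα⟩ := hα y hy.1
    refine ⟨hy0, ?_⟩
    have habs : |s| < min ε δ := abs_lt.2 hs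
    have hsε : ∀ t ∈ Set.Ioo (-(min ε δ)) (min ε δ), t ∈ Set.Ioo (-ε) ε := fun t ht =>
      abs_lt.1 ((abs_lt.2 ht).trans_le (min_le_left _ _))
    have hin : ∀ t ∈ Set.Ioo (-(min ε δ)) (min ε δ),
        α (t, y) ∈ W ∧ X' (α (t, y)) = X (α (t, y)) ∧ g' (α (t, y)) = g (α (t, y)) := by
      intro t ht
      refine @hnear (t, y) ?_
      rw [Prod.dist_eq]
      refine max_lt ?_ hy.2
      rw [Real.dist_eq, sub_zero]
      exact (abs_lt.2 ht).trans_le (min_le_right _ _)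
    have hder := hfg (fun t => α (t, y)) (-(min ε δ)) (min ε δ) fun t ht =>
      ⟨(hin t ht).1, (hin t ht).2.1 ▸ (hyα t (hsε t ht)).1⟩
    have hmul : ∀ σ ∈ Set.Icc (0 : ℝ) 1, σ * s ∈ Set.Ioo (-(min ε δ)) (min ε δ) := by
      intro σ hσ
      refine abs_lt.1 (lt_of_le_of_lt ?_ habs)
      rw [abs_mul, abs_of_nonneg hσ.1]
      exact mul_le_of_le_one_left (abs_nonneg _) hσ.2
    have hf' : ∀ σ ∈ Set.Icc (0 : ℝ) 1,
        HasDerivAt (fun σ => f (α (σ * s, y))) (s * g' (α (σ * s, y))) σ := by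
      intro σ hσ
      rw [(hin _ (hmul σ hσ)).2.2]
      exact (hder _ (hmul σ hσ)).scomp σ (hasDerivAt_mul_const s)
    have hftc : ∫ σ in (0 : ℝ)..1, s * g' (α (σ * s, y)) =
        f (α (1 * s, y)) - f (α (0 * s, y)) := by
      rw [← Set.uIcc_of_le zero_le_one] at hf' hmul
      refine intervalIntegral.integral_eq_sub_of_hasDerivAt hf'
        (ContinuousOn.intervalIntegrable fun σ hσ => ContinuousAt.continuousWithinAt ?_)
      have h1 : ContinuousAt (fun t => α (t, y)) (σ * s) :=
        (hyα _ (hsε _ (hmul σ hσ))).1.continuousAt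
      exact ((hg'.continuous.continuousAt.comp h1).comp
        (f := fun σ : ℝ => σ * s) (by fun_prop)).const_smul s
    rw [intervalIntegral.integral_const_mul, one_mul, zero_mul, hy0] at hftc
    have hcongr : primitive ℝ ((⟨g', hg'.continuous⟩ : C(E, ℝ)).comp (Γ (s, y))) 1 =
        ∫ σ in (0 : ℝ)..1, g' (α (σ * s, y)) := by
      rw [primitive_apply]
      refine intervalIntegral.integral_congr fun σ hσ => ?_
      rw [Set.Icc.coe_one, Set.uIcc_of_le zero_le_one] at hσ
      simp only [ContinuousMap.comp_apply, ContinuousMap.coe_mk]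
      rw [(hyα s (hsε s hs)).2, Set.projIcc_of_mem _ hσ]
    change f (α (s, y)) = f y + s * _
    rw [hcongr, hftc]
    ring

end Flow

/-! ### Vector fields tangent to an immersion -/

section Tangent

variable {E : Type*} [NormedAddCommGroup E] [NormedSpace ℝ E]
  {V : Type*} [NormedAddCommGroup V] [NormedSpace ℝ V]

/-- A vector field along which an immersion is tangent lifts to the parameter space, and the lift is
differentiable. -/
theorem exists_lift_of_mem_range [FiniteDimensional ℝ E] [FiniteDimensional ℝ V]
    {Φ : V → E} {t : V} (hΦ : ContDiffAt ℝ 2 Φ t)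
    (hinj : Function.Injective (fderiv ℝ Φ t)) {X : E → E} (hX : DifferentiableAt ℝ X (Φ t))
    (htan : ∀ᶠ t' in 𝓝 t, X (Φ t') ∈ Set.range (fderiv ℝ Φ t')) :
    ∃ Z : V → V, DifferentiableAt ℝ Z t ∧ ∀ᶠ t' in 𝓝 t, X (Φ t') = fderiv ℝ Φ t' (Z t') := by
  have : CompleteSpace V := FiniteDimensional.complete ℝ V
  obtain ⟨L₀, hL₀⟩ := LinearMap.exists_leftInverse_of_injective
    (fderiv ℝ Φ t : V →ₗ[ℝ] E) (LinearMap.ker_eq_bot.2 hinj)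
  let L : E →L[ℝ] V := LinearMap.toContinuousLinearMap L₀
  -- applying `L` to `X ∘ Φ = dΦ (Z)` gives `B (Z) = L (X ∘ Φ)`, and `B` is invertible near `t`
  let B : V → V →L[ℝ] V := fun t' => L ∘L fderiv ℝ Φ t'
  have hBt : B t = ContinuousLinearEquiv.refl ℝ V := by
    ext v
    exact LinearMap.congr_fun hL₀ v
  have hd : DifferentiableAt ℝ (fderiv ℝ Φ) t :=
    (hΦ.fderiv_right (m := 1) (by norm_num)).differentiableAt (by simp)
  have hB : DifferentiableAt ℝ B t := (differentiableAt_const L).clm_comp hd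
  have hBinv : DifferentiableAt ℝ (fun t' => (B t').inverse) t := by
    have h1 : DifferentiableAt ℝ (ContinuousLinearMap.inverse : (V →L[ℝ] V) → V →L[ℝ] V)
        (B t) := by
      rw [hBt]
      exact (contDiffAt_map_inverse (n := 1) (ContinuousLinearEquiv.refl ℝ V)).differentiableAt
        (by simp)
    exact h1.comp t hB
  have hΦd : DifferentiableAt ℝ Φ t := hΦ.differentiableAt (by simp)
  refine ⟨fun t' => (B t').inverse (L (X (Φ t'))),
    hBinv.clm_apply (L.differentiableAt.comp t (hX.comp t hΦd)), ?_⟩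
  have hopen : ∀ᶠ t' in 𝓝 t, B t' ∈ Set.range
      ((↑) : (V ≃L[ℝ] V) → V →L[ℝ] V) :=
    hB.continuousAt.eventually (ContinuousLinearEquiv.isOpen.mem_nhds ⟨_, hBt.symm⟩)
  filter_upwards [htan, hopen] with t' ht' he
  obtain ⟨v, hv⟩ := ht'
  obtain ⟨e, he⟩ := he
  have h1 : L (X (Φ t')) = e v := by
    rw [← hv]
    exact (DFunLike.congr_fun he v).symm
  rw [← he, ContinuousLinearMap.inverse_equiv, h1]
  simp [hv]

/-- Vector fields that are tangent to an immersion are closed under the Lie bracket. -/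
theorem lieBracket_mem_range_fderiv [FiniteDimensional ℝ E] [FiniteDimensional ℝ V]
    {Φ : V → E} {t : V} (hΦ : ContDiffAt ℝ 2 Φ t)
    (hinj : Function.Injective (fderiv ℝ Φ t)) {X Y : E → E}
    (hX : DifferentiableAt ℝ X (Φ t)) (hY : DifferentiableAt ℝ Y (Φ t))
    (hXt : ∀ᶠ t' in 𝓝 t, X (Φ t') ∈ Set.range (fderiv ℝ Φ t'))
    (hYt : ∀ᶠ t' in 𝓝 t, Y (Φ t') ∈ Set.range (fderiv ℝ Φ t')) :
    VectorField.lieBracket ℝ X Y (Φ t) ∈ Set.range (fderiv ℝ Φ t) := by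
  have hd : DifferentiableAt ℝ (fderiv ℝ Φ) t :=
    (hΦ.fderiv_right (m := 1) (by norm_num)).differentiableAt (by simp)
  have hΦd : DifferentiableAt ℝ Φ t := hΦ.differentiableAt (by simp)
  have hsymm : IsSymmSndFDerivAt ℝ Φ t := hΦ.isSymmSndFDerivAt (by simp)
  -- differentiate the identity `X ∘ Φ = dΦ (Z)`
  have key : ∀ {X : E → E} {Z : V → V}, DifferentiableAt ℝ X (Φ t) → DifferentiableAt ℝ Z t →
      (∀ᶠ t' in 𝓝 t, X (Φ t') = fderiv ℝ Φ t' (Z t')) → ∀ w : V,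
      fderiv ℝ X (Φ t) (fderiv ℝ Φ t w) =
        fderiv ℝ Φ t (fderiv ℝ Z t w) + fderiv ℝ (fderiv ℝ Φ) t w (Z t) := by
    intro X Z hX hZ he w
    have h1 := hX.hasFDerivAt.comp t hΦd.hasFDerivAt
    have h2 := hd.hasFDerivAt.clm_apply hZ.hasFDerivAt
    have h3 := h1.unique (h2.congr_of_eventuallyEq he)
    simpa using DFunLike.congr_fun h3 w
  obtain ⟨Z, hZ, hZe⟩ := exists_lift_of_mem_range hΦ hinj hX hXt
  obtain ⟨Z', hZ', hZe'⟩ := exists_lift_of_mem_range hΦ hinj hY hYt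
  refine ⟨fderiv ℝ Z' t (Z t) - fderiv ℝ Z t (Z' t), ?_⟩
  rw [VectorField.lieBracket, hZe.self_of_nhds, hZe'.self_of_nhds, key hY hZ' hZe', key hX hZ hZe,
    hsymm.eq (Z t) (Z' t), map_sub]
  abel

end Tangent

/-! ### Immersions into the singular set -/

section Singular

variable {E : Type*} [NormedAddCommGroup E] [NormedSpace ℝ E]
  {V : Type*} [NormedAddCommGroup V] [NormedSpace ℝ V]

/-- At `t`, the map `Φ` is an immersion (of class `C^(r+2)`) along which `f` is of class `C^r`, and
it takes values in the points of `U` at which `f` itself fails to be of class `C^r`. -/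
structure IsSingularImmersionAt (U : Set E) (r : ℕ) (f : E → ℝ) (Φ : V → E) (t : V) : Prop where
  contDiffAt : ContDiffAt ℝ (r + 2 : ℕ) Φ t
  injective : Function.Injective (fderiv ℝ Φ t)
  contDiffAt_comp : ContDiffAt ℝ r (f ∘ Φ) t
  mem : Φ t ∈ U
  singular : ¬ ContDiffAt ℝ r f (Φ t)

/-- A singular immersion has positive codimension: otherwise it is a local diffeomorphism, and `f`
would be of class `C^r`. -/
theorem IsSingularImmersionAt.finrank_lt [FiniteDimensional ℝ E] [FiniteDimensional ℝ V]
    {U : Set E} {r : ℕ} {f : E → ℝ} {Φ : V → E} {t : V} (h : IsSingularImmersionAt U r f Φ t) :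
    Module.finrank ℝ V < Module.finrank ℝ E := by
  have : CompleteSpace V := FiniteDimensional.complete ℝ V
  refine lt_of_le_of_ne (LinearMap.finrank_le_finrank_of_injective
    (f := (fderiv ℝ Φ t : V →ₗ[ℝ] E)) h.injective) fun heq => h.singular ?_
  let e : V ≃L[ℝ] E :=
    (LinearEquiv.ofInjectiveOfFinrankEq (fderiv ℝ Φ t : V →ₗ[ℝ] E) h.injective
      heq).toContinuousLinearEquiv
  have hn : ((r + 2 : ℕ) : WithTop ℕ∞) ≠ 0 := by
    exact_mod_cast (by omega : r + 2 ≠ 0)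
  have hd : HasFDerivAt Φ (e : V →L[ℝ] E) t := (h.contDiffAt.differentiableAt hn).hasFDerivAt
  have hs : HasStrictFDerivAt Φ (e : V →L[ℝ] E) t := h.contDiffAt.hasStrictFDerivAt' hd hn
  have hinv : ContDiffAt ℝ (r + 2 : ℕ) (hs.localInverse Φ e t) (Φ t) :=
    h.contDiffAt.to_localInverse hd hn
  have hcomp : ContDiffAt ℝ r ((f ∘ Φ) ∘ hs.localInverse Φ e t) (Φ t) := by
    refine ContDiffAt.comp _ ?_ (hinv.of_le (by exact_mod_cast (by omega : r ≤ r + 2)))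
    rw [hs.localInverse_apply_image]
    exact h.contDiffAt_comp
  refine hcomp.congr_of_eventuallyEq ?_
  filter_upwards [hs.eventually_right_inverse] with y hy
  simp [hy]

/-- If some point of the image of a singular immersion carries a vector field transverse to the
image, along which `f` has a `C^r` derivative, then the flow of that field sweeps out a singular
immersion with one more parameter. -/
theorem IsSingularImmersionAt.exists_extend [FiniteDimensional ℝ E] [FiniteDimensional ℝ V]
    {U : Set E} (hU : IsOpen U) {r : ℕ} {f : E → ℝ} {Φ : V → E} {t : V}
    (h : ∀ᶠ t' in 𝓝 t, IsSingularImmersionAt U r f Φ t') {X : E → E} {W : Set E} {g : E → ℝ}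
    (hfg : IsDerivAlong f X W g) (hW : W ∈ 𝓝 (Φ t)) (hX : ContDiffAt ℝ (r + 2 : ℕ) X (Φ t))
    (hg : ContDiffAt ℝ r g (Φ t)) (htrans : X (Φ t) ∉ Set.range (fderiv ℝ Φ t)) :
    ∃ Ψ : ℝ × V → E, ∀ᶠ q in 𝓝 (0, t), IsSingularImmersionAt U r f Ψ q := by
  have ht := h.self_of_nhds
  have hn : ((r + 2 : ℕ) : WithTop ℕ∞) ≠ 0 := by
    exact_mod_cast (by omega : r + 2 ≠ 0)
  have hni : ((r + 2 : ℕ) : WithTop ℕ∞) ≠ ∞ := by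
    generalize r + 2 = n
    simp
  have hrn : (r : WithTop ℕ∞) ≤ (r + 2 : ℕ) := by exact_mod_cast (by omega : r ≤ r + 2)
  obtain ⟨F, G, hF, hG, hFX, hFG⟩ := hfg.exists_flowBox (by omega : 1 ≤ r + 2)
    (by omega : r ≤ r + 2) hW hX hg
  have hF0 : F (0, Φ t) = Φ t := hFG.self_of_nhds.1
  -- the flow preserves the singular set
  have hsing : ∀ᶠ q in 𝓝 ((0 : ℝ), Φ t),
      ¬ ContDiffAt ℝ r f q.2 → ¬ ContDiffAt ℝ r f (F q) := by
    filter_upwards [hF.eventually hni, hG.eventually (by simp),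
      eventually_eventually_nhds.2 hFG] with q hFq hGq heq hq hcon
    apply hq
    have hin : ContDiffAt ℝ (r + 2 : ℕ) (fun y : E => (q.1, y)) q.2 :=
      contDiffAt_const.prodMk contDiffAt_id
    have h1 : ContDiffAt ℝ r (fun y => f (F (q.1, y)) - G (q.1, y)) q.2 :=
      (ContDiffAt.comp q.2 (g := f) (f := fun y => F (q.1, y)) hcon
        ((hFq.comp q.2 hin).of_le hrn)).sub (hGq.comp q.2 (hin.of_le hrn))
    refine h1.congr_of_eventuallyEq ?_
    have hcont : Filter.Tendsto (fun y : E => (q.1, y)) (𝓝 q.2) (𝓝 q) := hin.continuousAt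
    filter_upwards [hcont.eventually heq] with y hy
    simp [hy.2]
  have hpair : ContDiffAt ℝ (r + 2 : ℕ) (fun q : ℝ × V => (q.1, Φ q.2)) (0, t) :=
    contDiffAt_fst.prodMk (ht.contDiffAt.comp (0, t) contDiffAt_snd)
  have hpairc : Filter.Tendsto (fun q : ℝ × V => (q.1, Φ q.2)) (𝓝 (0, t)) (𝓝 (0, Φ t)) :=
    hpair.continuousAt
  have hΨ : ContDiffAt ℝ (r + 2 : ℕ) (fun q : ℝ × V => F (q.1, Φ q.2)) (0, t) :=
    ContDiffAt.comp (g := F) (0, t) hF hpair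
  have hinj : Function.Injective (fderiv ℝ (fun q : ℝ × V => F (q.1, Φ q.2)) (0, t)) := by
    set D := fderiv ℝ (fun q : ℝ × V => F (q.1, Φ q.2)) (0, t) with hD
    have hDd : HasFDerivAt (fun q : ℝ × V => F (q.1, Φ q.2)) D (0, t) :=
      (hΨ.differentiableAt hn).hasFDerivAt
    have h1 : D (1, 0) = X (Φ t) := by
      have h2 := hDd.comp_hasDerivAt (0 : ℝ)
        ((hasDerivAt_id (0 : ℝ)).prodMk (hasDerivAt_const (0 : ℝ) t))
      exact h2.unique hFX
    have h2 : ∀ v, D (0, v) = fderiv ℝ Φ t v := by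
      intro v
      have h3 : HasFDerivAt (fun t' : V => F (0, Φ t')) (D ∘L .inr ℝ ℝ V) t :=
        HasFDerivAt.comp (g := fun q : ℝ × V => F (q.1, Φ q.2)) t hDd (hasFDerivAt_prodMk_right _ _)
      have h4 : HasFDerivAt Φ (D ∘L .inr ℝ ℝ V) t := by
        refine h3.congr_of_eventuallyEq ?_
        have hc : Filter.Tendsto (fun t' : V => ((0 : ℝ), Φ t')) (𝓝 t) (𝓝 (0, Φ t)) :=
          continuousAt_const.prodMk ht.contDiffAt.continuousAt
        filter_upwards [hc.eventually hFG] with t' ht'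
        exact ht'.1.symm
      rw [h4.fderiv]
      rfl
    rw [injective_iff_map_eq_zero]
    rintro ⟨s, v⟩ hsv
    have h5 : s • X (Φ t) + fderiv ℝ Φ t v = 0 := by
      rw [← h1, ← h2, ← map_smul, ← map_add, ← hsv]
      simp
    have hs : s = 0 := by
      by_contra hs
      refine htrans ⟨-(s⁻¹ • v), ?_⟩
      rw [map_neg, map_smul, neg_eq_iff_eq_neg, inv_smul_eq_iff₀ hs, smul_neg,
        eq_neg_iff_add_eq_zero, add_comm]
      exact h5
    subst hs
    rw [zero_smul, zero_add] at h5
    rw [(injective_iff_map_eq_zero _).1 ht.injective v h5]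
    rfl
  have hcomp : ContDiffAt ℝ r (f ∘ fun q : ℝ × V => F (q.1, Φ q.2)) (0, t) := by
    have h1 : ContDiffAt ℝ r (fun q : ℝ × V => (f ∘ Φ) q.2 + G (q.1, Φ q.2)) (0, t) :=
      (ContDiffAt.comp (g := f ∘ Φ) (0, t) ht.contDiffAt_comp contDiffAt_snd).add
        (ContDiffAt.comp (g := G) (0, t) hG (hpair.of_le hrn))
    refine h1.congr_of_eventuallyEq ?_
    filter_upwards [hpairc.eventually hFG] with q hq
    exact hq.2
  refine ⟨fun q => F (q.1, Φ q.2), ?_⟩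
  have hfd : ContinuousAt (fderiv ℝ (fun q : ℝ × V => F (q.1, Φ q.2))) (0, t) :=
    (hΨ.fderiv_right (m := 0) (by exact_mod_cast (by omega : 0 + 1 ≤ r + 2))).continuousAt
  have hsnd : Filter.Tendsto (Prod.snd : ℝ × V → V) (𝓝 (0, t)) (𝓝 t) := continuousAt_snd
  filter_upwards [hΨ.eventually hni, hcomp.eventually (by simp),
    hfd.eventually (ContinuousLinearMap.isOpen_injective.mem_nhds hinj),
    hΨ.continuousAt.eventually (hU.mem_nhds (by simpa [hF0] using ht.mem)),
    hpairc.eventually hsing, hsnd.eventually h] with q h1 h2 h3 h4 h5 h6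
  exact ⟨h1, h3, h2, h4, h5 h6.singular⟩

/-- If every singular immersion admits, at parameters arbitrarily close to a given one, a transverse
vector field along which `f` has a `C^r` derivative, then `f` is of class `C^r`: a singular
immersion of maximal dimension could be extended. -/
theorem contDiffAt_of_exists_transverse [FiniteDimensional ℝ E] {U : Set E} (hU : IsOpen U)
    {r : ℕ} {f : E → ℝ}
    (htrans : ∀ (V : Type) [NormedAddCommGroup V] [NormedSpace ℝ V] [FiniteDimensional ℝ V]
      (Φ : V → E) (t : V), (∀ᶠ t' in 𝓝 t, IsSingularImmersionAt U r f Φ t') →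
      ∃ᶠ t' in 𝓝 t, ∃ (X : E → E) (W : Set E) (g : E → ℝ), IsDerivAlong f X W g ∧
        W ∈ 𝓝 (Φ t') ∧ ContDiffAt ℝ (r + 2 : ℕ) X (Φ t') ∧ ContDiffAt ℝ r g (Φ t') ∧
        X (Φ t') ∉ Set.range (fderiv ℝ Φ t')) {x : E} (hx : x ∈ U) :
    ContDiffAt ℝ r f x := by
  by_contra hcon
  have hall : ∀ k : ℕ, ∃ (V : Type) (_ : NormedAddCommGroup V) (_ : NormedSpace ℝ V)
      (_ : FiniteDimensional ℝ V) (Φ : V → E) (t : V), Module.finrank ℝ V = k ∧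
      ∀ᶠ t' in 𝓝 t, IsSingularImmersionAt U r f Φ t' := by
    intro k
    induction k with
    | zero =>
      refine ⟨PUnit, inferInstance, inferInstance, inferInstance, fun _ => x, PUnit.unit,
        Module.finrank_zero_of_subsingleton,
        Filter.Eventually.of_forall fun t => ⟨contDiffAt_const, ?_, contDiffAt_const, hx, hcon⟩⟩
      exact Function.injective_of_subsingleton _
    | succ k ih =>
      obtain ⟨V, _, _, _, Φ, t, hk, h⟩ := ih
      obtain ⟨t', ⟨X, W, g, hfg, hW, hX, hg, hXt⟩, ht'⟩ :=
        ((htrans V Φ t h).and_eventually (eventually_eventually_nhds.2 h)).exists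
      obtain ⟨Ψ, hΨ⟩ := IsSingularImmersionAt.exists_extend hU ht' hfg hW hX hg hXt
      refine ⟨ℝ × V, inferInstance, inferInstance, inferInstance, Ψ, (0, t'), ?_, hΨ⟩
      rw [Module.finrank_prod, hk, Module.finrank_self, add_comm]
  obtain ⟨V, _, _, _, Φ, t, hk, h⟩ := hall (Module.finrank ℝ E)
  exact h.self_of_nhds.finrank_lt.ne hk

end Singular

/-! ### Local flows and derivatives along integral curves -/

section Curves

theorem natCast_le_infty (n : ℕ) : (n : WithTop ℕ∞) ≤ ∞ := by
  exact_mod_cast (le_top : (n : ℕ∞) ≤ ⊤)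

variable {E : Type*} [NormedAddCommGroup E] [NormedSpace ℝ E]
  {M : Type*} [TopologicalSpace M] [ChartedSpace E M] [IsManifold 𝓘(ℝ, E) ∞ M]

theorem LocalVectorField.contMDiffAt (X : LocalVectorField E M) {x : M} (hx : x ∈ X.dom) :
    ContMDiffAt 𝓘(ℝ, E) 𝓘(ℝ, E).tangent ∞
      (fun x => (⟨x, X.field x⟩ : TangentBundle 𝓘(ℝ, E) M)) x :=
  X.smooth.contMDiffAt (X.isOpen_dom.mem_nhds hx)

/-- Integral curves of a local vector field that stay in its domain are unique on open intervals. -/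
theorem LocalVectorField.eqOn_of_isMIntegralCurveOn [CompleteSpace E] [T2Space M]
    (X : LocalVectorField E M) {γ γ' : ℝ → M} {a b t₀ : ℝ} (ht₀ : t₀ ∈ Set.Ioo a b)
    (hdom : Set.MapsTo γ (Set.Ioo a b) X.dom)
    (hγ : IsMIntegralCurveOn γ X.field (Set.Ioo a b))
    (hγ' : IsMIntegralCurveOn γ' X.field (Set.Ioo a b)) (h : γ t₀ = γ' t₀) :
    Set.EqOn γ γ' (Set.Ioo a b) := by
  -- the set of times at which the curves agree is open and closed in the interval
  have hcont : ∀ {η : ℝ → M}, IsMIntegralCurveOn η X.field (Set.Ioo a b) →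
      ContinuousOn η (Set.Ioo a b) := fun hη t ht => (hη t ht).continuousWithinAt
  have hopen : IsOpen {t | t ∈ Set.Ioo a b ∧ γ t = γ' t} := by
    rw [isOpen_iff_mem_nhds]
    rintro t ⟨ht, heq⟩
    have hmem := Ioo_mem_nhds ht.1 ht.2
    have := isMIntegralCurveAt_eventuallyEq_of_contMDiffAt_boundaryless
      ((X.contMDiffAt (hdom ht)).of_le (by simp)) (hγ.isMIntegralCurveAt hmem)
      (hγ'.isMIntegralCurveAt hmem) heq
    filter_upwards [this, hmem] with s h1 h2 using ⟨h2, h1⟩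
  have hopen' : IsOpen {t | t ∈ Set.Ioo a b ∧ γ t ≠ γ' t} := by
    rw [isOpen_iff_mem_nhds]
    rintro t ⟨ht, hne⟩
    have hmem := Ioo_mem_nhds ht.1 ht.2
    filter_upwards [(hcont hγ).continuousAt hmem |>.tendsto.prodMk_nhds
      ((hcont hγ').continuousAt hmem).tendsto |>.eventually
        (isClosed_diagonal.isOpen_compl.mem_nhds hne), hmem] with s h1 h2 using ⟨h2, h1⟩
  intro t ht
  by_contra hne
  obtain ⟨s, -, h1, h2⟩ := isPreconnected_Ioo _ _ hopen hopen'
    (fun s hs => (em (γ s = γ' s)).imp (fun h => ⟨hs, h⟩) (fun h => ⟨hs, h⟩))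
    ⟨t₀, ht₀, ht₀, h⟩ ⟨t, ht, ht, hne⟩
  exact h2.2 h1.2

/-- The flow follows any integral curve in the domain of the vector field. -/
theorem LocalVectorField.flow_eq [CompleteSpace E] [T2Space M]
    (X : LocalVectorField E M) {γ : ℝ → M} {a b t : ℝ} (h0 : (0 : ℝ) ∈ Set.Ioo a b)
    (ht : t ∈ Set.Ioo a b) (hdom : Set.MapsTo γ (Set.Ioo a b) X.dom)
    (hγ : IsMIntegralCurveOn γ X.field (Set.Ioo a b)) : X.flow t (γ 0) = γ t := by
  have hex : ∃ η : ℝ → M, η 0 = γ 0 ∧ ∃ a b : ℝ, 0 ∈ Set.Ioo a b ∧ t ∈ Set.Ioo a b ∧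
      Set.MapsTo η (Set.Ioo a b) X.dom ∧ IsMIntegralCurveOn η X.field (Set.Ioo a b) :=
    ⟨γ, rfl, a, b, h0, ht, hdom, hγ⟩
  rw [LocalVectorField.flow, dif_pos hex]
  obtain ⟨hη0, a', b', h0', ht', hdom', hη⟩ := hex.choose_spec
  have hsub : Set.Ioo (max a a') (min b b') ⊆ Set.Ioo a b :=
    Set.Ioo_subset_Ioo (le_max_left _ _) (min_le_left _ _)
  have hsub' : Set.Ioo (max a a') (min b b') ⊆ Set.Ioo a' b' :=
    Set.Ioo_subset_Ioo (le_max_right _ _) (min_le_right _ _)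
  have hmem : ∀ {s : ℝ}, s ∈ Set.Ioo a b → s ∈ Set.Ioo a' b' →
      s ∈ Set.Ioo (max a a') (min b b') :=
    fun h h' => ⟨max_lt h.1 h'.1, lt_min h.2 h'.2⟩
  exact X.eqOn_of_isMIntegralCurveOn (hmem h0 h0') (hdom'.mono_left hsub') (hη.mono hsub')
    (hγ.mono hsub) hη0 (hmem ht ht')

/-- If the flow derivative of `f` along `X` exists, it is the derivative of `f` along every integral
curve of `X` at every time. -/
theorem LocalVectorField.hasDerivAt_comp_isMIntegralCurveOn [CompleteSpace E] [T2Space M]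
    (X : LocalVectorField E M) {f : M → ℝ} (hf : ∀ x ∈ X.dom, X.HasFlowDerivAt f x)
    {γ : ℝ → M} {a b t : ℝ} (ht : t ∈ Set.Ioo a b) (hdom : Set.MapsTo γ (Set.Ioo a b) X.dom)
    (hγ : IsMIntegralCurveOn γ X.field (Set.Ioo a b)) :
    HasDerivAt (fun s => f (γ s)) (X.flowDeriv f (γ t)) t := by
  have h1 : HasDerivAt (fun s => f (X.flow s (γ t))) (X.flowDeriv f (γ t)) 0 :=
    (hf _ (hdom ht)).hasDerivAt
  have hset : Set.Ioo (a - t) (b - t) = {s | s + t ∈ Set.Ioo a b} := by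
    ext s
    simp [sub_lt_iff_lt_add, lt_sub_iff_add_lt]
  have hshift : IsMIntegralCurveOn (γ ∘ (· + t)) X.field (Set.Ioo (a - t) (b - t)) :=
    hset ▸ hγ.comp_add t
  have h0 : (0 : ℝ) ∈ Set.Ioo (a - t) (b - t) := ⟨by linarith [ht.1], by linarith [ht.2]⟩
  have h2 : HasDerivAt (fun s => f (γ (s + t))) (X.flowDeriv f (γ t)) 0 := by
    refine h1.congr_of_eventuallyEq ?_
    filter_upwards [Ioo_mem_nhds h0.1 h0.2] with s hs
    have := X.flow_eq h0 hs (fun u hu => hdom (by rw [hset] at hu; exact hu)) hshift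
    simp only [zero_add] at this
    rw [this]
  have h3 : HasDerivAt (fun s => f (γ (s + t))) (X.flowDeriv f (γ t)) (t - t) := by
    rwa [sub_self]
  simpa using h3.comp_sub_const t t

end Curves

/-! ### Passage to a chart -/

section Chart

variable {E : Type*} [NormedAddCommGroup E] [NormedSpace ℝ E]
  {M : Type*} [TopologicalSpace M] [ChartedSpace E M] [IsManifold 𝓘(ℝ, E) ∞ M]

theorem contMDiffAt_extChartAt_symm_of_mem {x₀ : M} {y : E}
    (hy : y ∈ (extChartAt 𝓘(ℝ, E) x₀).target) :
    ContMDiffAt 𝓘(ℝ, E) 𝓘(ℝ, E) ∞ (extChartAt 𝓘(ℝ, E) x₀).symm y :=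
  (contMDiffOn_extChartAt_symm x₀).contMDiffAt ((isOpen_extChartAt_target x₀).mem_nhds hy)

theorem isInvertible_mfderiv_extChartAt_symm {x₀ : M} {y : E}
    (hy : y ∈ (extChartAt 𝓘(ℝ, E) x₀).target) :
    (mfderiv 𝓘(ℝ, E) 𝓘(ℝ, E) (extChartAt 𝓘(ℝ, E) x₀).symm y).IsInvertible := by
  have : IsManifold 𝓘(ℝ, E) 1 M := IsManifold.of_le (n := ∞) (by simp)
  have := isInvertible_mfderivWithin_extChartAt_symm hy
  rwa [modelWithCornersSelf_coe, Set.range_id, mfderivWithin_univ] at this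

/-- The representation of a local vector field in the chart around `x₀`: its pullback under the
inverse of the chart. It is meaningful on `LocalVectorField.chartDom` only. -/
def LocalVectorField.inChart (x₀ : M) (X : LocalVectorField E M) : E → E :=
  VectorField.mpullback 𝓘(ℝ, E) 𝓘(ℝ, E) (extChartAt 𝓘(ℝ, E) x₀).symm X.field

/-- The domain of the representation of a local vector field in the chart around `x₀`. -/
def LocalVectorField.chartDom (x₀ : M) (X : LocalVectorField E M) : Set E :=
  (extChartAt 𝓘(ℝ, E) x₀).target ∩ (extChartAt 𝓘(ℝ, E) x₀).symm ⁻¹' X.dom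

theorem LocalVectorField.isOpen_chartDom (x₀ : M) (X : LocalVectorField E M) :
    IsOpen (X.chartDom x₀) :=
  (continuousOn_extChartAt_symm x₀).isOpen_inter_preimage (isOpen_extChartAt_target x₀)
    X.isOpen_dom

theorem LocalVectorField.mfderiv_inChart (x₀ : M) (X : LocalVectorField E M) {y : E}
    (hy : y ∈ (extChartAt 𝓘(ℝ, E) x₀).target) :
    mfderiv 𝓘(ℝ, E) 𝓘(ℝ, E) (extChartAt 𝓘(ℝ, E) x₀).symm y (X.inChart (E := E) x₀ y) =
      X.field ((extChartAt 𝓘(ℝ, E) x₀).symm y) :=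
  ((isInvertible_mfderiv_extChartAt_symm hy).inverse_apply_eq.1 rfl).symm

theorem LocalVectorField.contDiffAt_inChart [CompleteSpace E] (x₀ : M) (X : LocalVectorField E M)
    {y : E} (hy : y ∈ X.chartDom x₀) : ContDiffAt ℝ ∞ (X.inChart x₀) y := by
  have h := ContMDiffAt.mpullback_vectorField_preimage (m := ∞) (n := ∞) (X.contMDiffAt hy.2)
    (contMDiffAt_extChartAt_symm_of_mem hy.1) (isInvertible_mfderiv_extChartAt_symm hy.1) (by simp)
  exact contMDiffAt_vectorSpace_iff_contDiffAt.1 h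

theorem LocalVectorField.inChart_bracket [FiniteDimensional ℝ E] (x₀ : M)
    (X Y : LocalVectorField E M) {y : E} (hX : y ∈ X.chartDom x₀) (hY : y ∈ Y.chartDom x₀) :
    (X.bracket Y).inChart x₀ y = VectorField.lieBracket ℝ (X.inChart x₀) (Y.inChart x₀) y := by
  have : CompleteSpace E := FiniteDimensional.complete ℝ E
  have : IsManifold 𝓘(ℝ, E) (minSmoothness ℝ 3) M :=
    IsManifold.of_le (n := ∞) (by simpa using natCast_le_infty 3)
  have h := VectorField.mpullback_mlieBracket (n := ∞) (f := (extChartAt 𝓘(ℝ, E) x₀).symm)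
    ((X.contMDiffAt hX.2).mdifferentiableAt (by simp))
    ((Y.contMDiffAt hY.2).mdifferentiableAt (by simp))
    (contMDiffAt_extChartAt_symm_of_mem hX.1) (by simpa using natCast_le_infty 2)
  rw [← VectorField.mlieBracketWithin_univ (V := VectorField.mpullback _ _ _ _),
    VectorField.mlieBracketWithin_eq_lieBracketWithin] at h
  refine h.trans ?_
  change VectorField.lieBracketWithin ℝ (X.inChart x₀) (Y.inChart x₀) Set.univ y = _
  rw [VectorField.lieBracketWithin_univ]

/-- The derivative of `f` along the flow of `X`, read in a chart. -/
theorem LocalVectorField.isDerivAlong_inChart [CompleteSpace E] [T2Space M] (x₀ : M)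
    (X : LocalVectorField E M) {f : M → ℝ} (hf : ∀ x ∈ X.dom, X.HasFlowDerivAt f x) :
    IsDerivAlong (f ∘ (extChartAt 𝓘(ℝ, E) x₀).symm) (X.inChart x₀) (X.chartDom x₀)
      (X.flowDeriv f ∘ (extChartAt 𝓘(ℝ, E) x₀).symm) := by
  intro γ a b hγ t ht
  refine X.hasDerivAt_comp_isMIntegralCurveOn hf
    (γ := fun s => (extChartAt 𝓘(ℝ, E) x₀).symm (γ s)) ht (fun s hs => (hγ s hs).1.2) ?_
  intro s hs
  obtain ⟨hmem, hd⟩ := hγ s hs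
  have h1 := ((contMDiffAt_extChartAt_symm_of_mem hmem.1).mdifferentiableAt
    (by simp)).hasMFDerivAt
  have h2 := (h1.comp s hd.hasFDerivAt.hasMFDerivAt).hasMFDerivWithinAt (s := Set.Ioo a b)
  refine h2.congr_mfderiv ?_
  ext
  exact (map_smul _ _ _).trans (congrArg _ (X.mfderiv_inChart x₀ hmem.1))

end Chart

end Subriemannian

end

theorem mainTheorem1
    {E : Type*} [NormedAddCommGroup E] [NormedSpace ℝ E] [FiniteDimensional ℝ E]
    {M : Type*} [TopologicalSpace M] [T2Space M] [ParacompactSpace M]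
    [ChartedSpace E M] [IsManifold 𝓘(ℝ, E) ∞ M]
    (H : Subriemannian.Distribution E M)
    (hfin : H.IsLocallyFinitelyGenerated) (hgen : H.IsBracketGenerating)
    (r : ℕ) (f : M → ℝ)
    (hf : ∀ X ∈ H.horizontalFields,
      (∀ x ∈ X.dom, X.HasFlowDerivAt f x) ∧
        ContMDiffOn 𝓘(ℝ, E) 𝓘(ℝ, ℝ) r (X.flowDeriv f) X.dom) :
    ContMDiff 𝓘(ℝ, E) 𝓘(ℝ, ℝ) r f := by
  have : CompleteSpace E := FiniteDimensional.complete ℝ E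
  intro x₀
  set c := extChartAt 𝓘(ℝ, E) x₀ with hc
  suffices h : ContDiffAt ℝ r (f ∘ c.symm) (c x₀) by
    have h1 : ContMDiffAt 𝓘(ℝ, E) 𝓘(ℝ, ℝ) r ((f ∘ c.symm) ∘ c) x₀ :=
      h.contMDiffAt.comp x₀ ((contMDiffAt_extChartAt (n := ∞)).of_le
        (Subriemannian.natCast_le_infty r))
    refine h1.congr_of_eventuallyEq ?_
    filter_upwards [extChartAt_source_mem_nhds (I := 𝓘(ℝ, E)) x₀] with x hx
    simp only [Function.comp_apply]
    rw [hc, (extChartAt 𝓘(ℝ, E) x₀).left_inv hx]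
  refine Subriemannian.contDiffAt_of_exists_transverse (isOpen_extChartAt_target x₀) ?_
    (mem_extChartAt_target x₀)
  intro V _ _ _ Φ t h
  by_contra hnot
  -- otherwise all horizontal fields are tangent to `Φ` on an open set `T`, hence so is the Lie hull
  obtain ⟨T, hT, hTopen, htT⟩ := eventually_nhds_iff.1 (h.and (Filter.not_frequently.1 hnot))
  let S : Set (Subriemannian.LocalVectorField E M) :=
    {Z | ∀ t' ∈ T, Φ t' ∈ Z.chartDom x₀ → Z.inChart x₀ (Φ t') ∈ Set.range (fderiv ℝ Φ t')}
  have hHS : H.horizontalFields ⊆ S := by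
    intro X hX t' ht' hmem
    by_contra hXt
    have hopen := X.isOpen_chartDom x₀
    refine (hT t' ht').2 ⟨X.inChart x₀, X.chartDom x₀, X.flowDeriv f ∘ c.symm,
      X.isDerivAlong_inChart x₀ (hf X hX).1, hopen.mem_nhds hmem,
      (X.contDiffAt_inChart x₀ hmem).of_le (Subriemannian.natCast_le_infty _), ?_, hXt⟩
    have h1 := ((hf X hX).2.contMDiffAt (X.isOpen_dom.mem_nhds hmem.2)).comp (Φ t')
      ((Subriemannian.contMDiffAt_extChartAt_symm_of_mem hmem.1).of_le
        (Subriemannian.natCast_le_infty r))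
    exact h1.contDiffAt
  have hS : Subriemannian.IsInvolutive S := by
    intro X hX Y hY t' ht' hmem
    have hmX : Φ t' ∈ X.chartDom x₀ := ⟨hmem.1, hmem.2.1⟩
    have hmY : Φ t' ∈ Y.chartDom x₀ := ⟨hmem.1, hmem.2.2⟩
    have hΦ := (hT t' ht').1
    rw [X.inChart_bracket x₀ Y hmX hmY]
    have htan : ∀ {Z : Subriemannian.LocalVectorField E M}, Z ∈ S → Φ t' ∈ Z.chartDom x₀ →
        ∀ᶠ t'' in 𝓝 t', Z.inChart x₀ (Φ t'') ∈ Set.range (fderiv ℝ Φ t'') := by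
      intro Z hZ hm
      filter_upwards [hTopen.mem_nhds ht',
        hΦ.contDiffAt.continuousAt.eventually ((Z.isOpen_chartDom x₀).mem_nhds hm)] with t'' h1 h2
      exact hZ t'' h1 h2
    exact Subriemannian.lieBracket_mem_range_fderiv
      (hΦ.contDiffAt.of_le (by exact_mod_cast (by omega : 2 ≤ r + 2))) hΦ.injective
      ((X.contDiffAt_inChart x₀ hmX).differentiableAt (by simp))
      ((Y.contDiffAt_inChart x₀ hmY).differentiableAt (by simp)) (htan hX hmX) (htan hY hmY)
  have hhull : Subriemannian.lieHull H.horizontalFields ⊆ S := Set.sInter_subset_of_mem ⟨hHS, hS⟩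
  have hΦ := (hT t htT).1
  -- the Lie hull spans the tangent space, so `dΦ` is onto, which its dimension forbids
  let A : E →L[ℝ] E := mfderiv 𝓘(ℝ, E) 𝓘(ℝ, E) c.symm (Φ t)
  have hAinj : Function.Injective A :=
    (Subriemannian.isInvertible_mfderiv_extChartAt_symm hΦ.mem).injective
  have hsub : Subriemannian.spanDistribution (Subriemannian.lieHull H.horizontalFields)
      (c.symm (Φ t)) ≤ ((fderiv ℝ Φ t : V →ₗ[ℝ] E).range).map (A : E →ₗ[ℝ] E) := by
    refine Submodule.span_le.2 ?_
    rintro v ⟨Z, hZ, hdom, rfl⟩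
    have hmem : Φ t ∈ Z.chartDom x₀ := ⟨hΦ.mem, hdom⟩
    exact ⟨Z.inChart x₀ (Φ t), hhull hZ t htT hmem, Z.mfderiv_inChart x₀ hΦ.mem⟩
  rw [hgen] at hsub
  have hsurj : Function.Surjective (fderiv ℝ Φ t) := by
    intro w
    obtain ⟨w', ⟨v, rfl⟩, hw'⟩ := hsub (Submodule.mem_top (x := A w))
    exact ⟨v, hAinj hw'⟩
  exact hΦ.finrank_lt.not_ge (LinearMap.finrank_le_finrank_of_surjective
    (f := (fderiv ℝ Φ t : V →ₗ[ℝ] E)) hsurj)
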